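/- Let $a,b,c_0>0$. There is a nondecreasing function $C:\mathbb{R}\to\mathbb{R}$, depending only on $a,b,c_0$, such that the following holds for all integers $d,n,k\ge 1$ and $m$ with $m\ge c_0k^2d$, all symmetric $\Lambda\in\mathbb{R}^{d\times d}$ with all eigenvalues in $[a,b]$, and all real $c\ne 0$. Let $\Gamma=(1+\frac1n)\Lambda+\frac1n\operatorname{tr}(\Lambda)I_d$, where $n$ is the length of the training prompts. Consider the linear self-attention layer $$f(E)=E+VE\cdot\frac{E^\top WE}{m}$$ with the trained parameters (blocks of sizes $d,1,d,1$): $V$ has the single nonzero block $V_{31}=-\Gamma^{-1}/c$, and $W$ has the only nonzero blocks $W_{13}=cI_d$ and $W_{24}=-c$. Let $x_1,\dots,x_m\sim\mathcal N(0,\Lambda)$ and $w_{\rm test}\sim\mathcal N(0,I_d)$ be independent, $X=[x_1|\cdots|x_m]$ and $y=w_{\rm test}^\top X$. The test-time chain of thought starts at $w_0=0$, and $w_{i+1}$ consists of the entries $d+2,\dots,2d+1$ of the last column of $f(E_i)$, where $$E_i=\begin{bmatrix}X&0&\cdots&0\\ y&0&\cdots&0\\ 0&w_0&\cdots&w_i\\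 0&1&\cdots&1\end{bmatrix}.$$ Then, for both $j=k$ and $j=k+1$, $\|w_j-w_{\rm test}\|_2^2$ is integrable and $$\mathbb{E}\,\|w_j-w_{\rm test}\|_2^2\le \operatorname{tr}\big((I-\Gamma^{-1}\Lambda)^{2k}\big)\Big(1+C(n/d)\,k\sqrt{d/m}\Big).$$ In particular the factor is $1+O(k\sqrt{d/m})$, with a constant that does not depend on $d,m,k,\Lambda,c$, when $n$ is fixed and, more generally, when $n/d$ stays bounded. -/

import Mathlib

open MeasureTheory ProbabilityTheory

noncomputable section

/-- Row index of the embedding matrices, of size `2 * d + 2`: the feature block (`d` rows), the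
label row, the weight block (`d` rows) and the constant row, in this order. -/
abbrev EmbRow (d : ℕ) : Type := (Fin d ⊕ Unit) ⊕ (Fin d ⊕ Unit)

/-- One layer of linear self-attention with residual connection,
`E + V E (Eᵀ W E / ρ)`. -/
def lsa {R S : Type*} [Fintype R] [Fintype S] (ρ : ℝ) (V W : Matrix R R ℝ) (E : Matrix R S ℝ) :
    Matrix R S ℝ :=
  E + V * E * (ρ⁻¹ • (E.transpose * W * E))

/-- The preconditioner `Γ = (1 + 1/n) Λ + (1/n) tr(Λ) I` of a model trained on prompts of
length `n`. -/
def gammaMat {d : ℕ} (n : ℕ) (Λ : Matrix (Fin d) (Fin d) ℝ) : Matrix (Fin d) (Fin d) ℝ :=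
  (1 + 1 / (n : ℝ)) • Λ + (1 / (n : ℝ) * Λ.trace) • (1 : Matrix (Fin d) (Fin d) ℝ)

/-- The trained value matrix: its only nonzero block is `-Γ⁻¹ / c`, in the rows of the weight block
and the columns of the feature block. -/
def trainedV {d : ℕ} (c : ℝ) (n : ℕ) (Λ : Matrix (Fin d) (Fin d) ℝ) :
    Matrix (EmbRow d) (EmbRow d) ℝ :=
  Matrix.fromBlocks 0 0 (Matrix.fromBlocks (-(c⁻¹ • (gammaMat n Λ)⁻¹)) 0 0 0) 0

/-- The trained key-query matrix: `c I` at (feature, weight) and `-c` at (label, constant). -/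
def trainedW (d : ℕ) (c : ℝ) : Matrix (EmbRow d) (EmbRow d) ℝ :=
  Matrix.fromBlocks 0
    (Matrix.fromBlocks (c • (1 : Matrix (Fin d) (Fin d) ℝ)) 0 0 (-(c • (1 : Matrix Unit Unit ℝ))))
    0 0

/-- The embedding of a test prompt with features `x₁, …, x_m` and labels `⟨w, x₁⟩, …, ⟨w, x_m⟩`,
followed by the chain `u₀, …, u_i` of weight estimates generated so far. -/
def embedding {d m : ℕ} (x : Fin m → EuclideanSpace ℝ (Fin d)) (w : EuclideanSpace ℝ (Fin d))
    {i : ℕ} (u : Fin (i + 1) → EuclideanSpace ℝ (Fin d)) :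
    Matrix (EmbRow d) (Fin m ⊕ Fin (i + 1)) ℝ :=
  Matrix.fromBlocks
    (Matrix.fromRows (Matrix.of fun a j => x j a) (Matrix.of fun _ j => inner ℝ w (x j)))
    0 0
    (Matrix.fromRows (Matrix.of fun a j => u j a) (Matrix.of fun _ _ => 1))

/-- The next link of the chain: the weight block of the last column of the output of the trained
linear self-attention layer on the current embedding, with the normalization `ρ = m` at test
time. -/
def nextLink {d m : ℕ} (c : ℝ) (n : ℕ) (Λ : Matrix (Fin d) (Fin d) ℝ)
    (x : Fin m → EuclideanSpace ℝ (Fin d)) (w : EuclideanSpace ℝ (Fin d))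
    {i : ℕ} (u : Fin (i + 1) → EuclideanSpace ℝ (Fin d)) : EuclideanSpace ℝ (Fin d) :=
  WithLp.toLp 2 fun a =>
    lsa (m : ℝ) (trainedV c n Λ) (trainedW d c) (embedding x w u)
      (Sum.inr (Sum.inl a)) (Sum.inr (Fin.last i))

/-- The chain `w₀ = 0, w₁, …, w_i` generated at test time; every new link is appended to the
embedding. -/
def cotChain {d m : ℕ} (c : ℝ) (n : ℕ) (Λ : Matrix (Fin d) (Fin d) ℝ)
    (x : Fin m → EuclideanSpace ℝ (Fin d)) (w : EuclideanSpace ℝ (Fin d)) :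
    (i : ℕ) → Fin (i + 1) → EuclideanSpace ℝ (Fin d)
  | 0 => fun _ => 0
  | i + 1 =>
    Fin.snoc (α := fun _ => EuclideanSpace ℝ (Fin d)) (cotChain c n Λ x w i)
      (nextLink c n Λ x w (cotChain c n Λ x w i))

/-- The weight estimate `w_i` of the test-time chain of thought. -/
def cotEstimate {d m : ℕ} (c : ℝ) (n : ℕ) (Λ : Matrix (Fin d) (Fin d) ℝ)
    (x : Fin m → EuclideanSpace ℝ (Fin d)) (w : EuclideanSpace ℝ (Fin d)) (i : ℕ) :
    EuclideanSpace ℝ (Fin d) :=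
  cotChain c n Λ x w i (Fin.last i)

/-- The joint law of the test prompt features and of the test weight: `x₁, …, x_m` are i.i.d.
`N(0, Λ)`, and `w_test ~ N(0, I)` is independent of them. -/
def testLaw {d : ℕ} (m : ℕ) (Λ : Matrix (Fin d) (Fin d) ℝ) :
    Measure ((Fin m → EuclideanSpace ℝ (Fin d)) × EuclideanSpace ℝ (Fin d)) :=
  (Measure.pi fun _ : Fin m => multivariateGaussian 0 Λ).prod
    (multivariateGaussian 0 (1 : Matrix (Fin d) (Fin d) ℝ))

end

/-! The chain is preconditioned gradient descent: with `S` the empirical covariance and `R = 1 - Γ⁻¹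
S`, the error after `j` links is `-R ^ j w_test`, and averaging over `w_test` leaves `tr ((R ^ j)ᵀ R
^ j)`. Put `A = 1 - Γ⁻¹ Λ`, so that `0 ≤ A ≤ 1`. One can write `Γ⁻¹ = A P` with `‖P‖ ≤ r = n / (d
a)`, hence `R = A (1 + P (Λ - S))`: sampling noise perturbs `A` multiplicatively. The Hölder type
inequality `abs_trace_prod_diagonal_mul_le` then bounds the loss by `tr (A ^ (2k)) (1 + r ‖Λ - S‖) ^
(4k)`, with no factor of the dimension.

It remains to show that this moment is `1 + O(τ)`, where `τ = √c₀ k √(d/m) ≤ 1`. Exponential moments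
of `‖Λ - S‖` follow from those of its quadratic form by averaging over the unit ball, at a cost of
`2 * 4 ^ d`. Passing to the `d`-th power of the moment reduces this cost to a constant, and
convexity extracts the small factor `τ` (`lintegral_one_add_pow_le`). -/

open scoped Matrix.Norms.L2Operator NNReal

/-! ### A Hölder inequality for traces of matrix words -/

/-- A nonnegative function is a nonnegative combination of indicators of nested sets. -/
theorem exists_antitone_layers {d : ℕ} (α : Fin d → ℝ) (hα : ∀ i, 0 ≤ α i) :
    ∃ (β : Fin d → ℝ) (S : Fin d → Finset (Fin d)), (∀ j, 0 ≤ β j) ∧ Antitone S ∧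
      ∀ i, α i = ∑ j, if i ∈ S j then β j else 0 := by
  set σ := Tuple.sort α
  have hf : Monotone (α ∘ σ) := Tuple.monotone_sort α
  -- The sorted values are shifted by one, with `g 0 = 0` as ground level. The layer heights are the
  -- increments of `g`, and layer `j` holds the indices of rank at least `j`.
  set g : ℕ → ℝ := fun n => if h : 0 < n ∧ n - 1 < d then α (σ ⟨n - 1, h.2⟩) else 0 with hg
  have hg1 : ∀ j : Fin d, g (j + 1) = α (σ j) := fun j => by simp [hg]
  refine ⟨fun j => g (j + 1) - g j, fun j => Finset.univ.filter fun i => j ≤ σ.symm i, ?_, ?_, ?_⟩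
  · intro j
    change 0 ≤ g (j + 1) - g j
    rw [hg1, sub_nonneg]
    by_cases h : 0 < (j : ℕ) ∧ (j : ℕ) - 1 < d
    · simp only [hg, dif_pos h]
      exact hf (Fin.mk_le_of_le_val (by simp))
    · simp only [hg, dif_neg h]
      exact hα _
  · intro j j' h i hi
    simp only [Finset.mem_filter, Finset.mem_univ, true_and] at hi ⊢
    exact h.trans hi
  · intro i
    simp only [Finset.mem_filter, Finset.mem_univ, true_and]
    have h0 : ∑ x ∈ Finset.range ((σ.symm i : ℕ) + 1), (g (x + 1) - g x) = α i := by
      rw [Finset.sum_range_sub, hg1]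
      simp [hg]
    have h1 := Fin.sum_univ_eq_sum_range
      (fun x => if x ≤ (σ.symm i : ℕ) then g (x + 1) - g x else 0) d
    simp only [Fin.le_def]
    rw [h1, ← h0, ← Finset.sum_filter]
    refine Finset.sum_congr ?_ fun _ _ => rfl
    ext x
    simp only [Finset.mem_range, Finset.mem_filter]
    have := (σ.symm i).2
    omega

section
variable {d : ℕ}

theorem abs_apply_le_l2_opNorm (M : Matrix (Fin d) (Fin d) ℝ) (i j : Fin d) : |M i j| ≤ ‖M‖ := by
  have h := Matrix.l2_opNorm_mulVec M (EuclideanSpace.single j (1 : ℝ))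
  have h2 := PiLp.norm_apply_le
    ((EuclideanSpace.equiv (Fin d) ℝ).symm (M.mulVec (EuclideanSpace.single j (1 : ℝ)).ofLp)) i
  simpa using h2.trans h

/-- The coordinate projection onto `S`, as a matrix. -/
def coordProj (S : Finset (Fin d)) : Matrix (Fin d) (Fin d) ℝ :=
  Matrix.diagonal fun i => if i ∈ S then 1 else 0

theorem norm_coordProj_le (S : Finset (Fin d)) : ‖coordProj S‖ ≤ 1 := by
  rw [coordProj, Matrix.l2_opNorm_diagonal, pi_norm_le_iff_of_nonneg zero_le_one]
  intro i
  split_ifs <;> simp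

theorem abs_trace_coordProj_mul_le (S : Finset (Fin d)) (M : Matrix (Fin d) (Fin d) ℝ) :
    |(coordProj S * M).trace| ≤ S.card * ‖M‖ := by
  have h : (coordProj S * M).trace = ∑ i ∈ S, M i i := by
    simp [Matrix.trace, coordProj, Matrix.diagonal_mul, Finset.sum_ite_mem]
  rw [h]
  refine (Finset.abs_sum_le_sum_abs _ _).trans ?_
  rw [← nsmul_eq_mul]
  exact Finset.sum_le_card_nsmul _ _ _ fun i _ => abs_apply_le_l2_opNorm M i i

theorem norm_mul_list_prod_le {ι : Type*} (X : ι → Matrix (Fin d) (Fin d) ℝ) (c : ι → ℝ)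
    (h : ∀ s, ‖X s‖ ≤ c s) (l : List ι) (M : Matrix (Fin d) (Fin d) ℝ) :
    ‖M * (l.map X).prod‖ ≤ ‖M‖ * (l.map c).prod := by
  induction l generalizing M with
  | nil => simp
  | cons s l ih =>
    simp only [List.map_cons, List.prod_cons]
    rw [← mul_assoc, ← mul_assoc]
    refine (ih _).trans (mul_le_mul_of_nonneg_right ?_ ?_)
    · exact (norm_mul_le _ _).trans (mul_le_mul_of_nonneg_left (h s) (norm_nonneg _))
    · refine List.prod_nonneg fun x hx => ?_
      obtain ⟨t, -, rfl⟩ := List.mem_map.1 hx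
      exact (norm_nonneg _).trans (h t)

/-- Cyclicity of the trace brings any chosen projection to the front; the other projections have
norm at most one. The freedom in `s` lets the smallest set be used. -/
theorem abs_trace_prod_coordProj_mul_le {N : ℕ} (S : Fin N → Finset (Fin d))
    (M : Fin N → Matrix (Fin d) (Fin d) ℝ) (s : Fin N) :
    |(List.ofFn fun t => coordProj (S t) * M t).prod.trace| ≤ (S s).card * ∏ t, ‖M t‖ := by
  obtain ⟨l₁, l₂, hl⟩ := List.append_of_mem (List.mem_finRange s)
  have hprod : ∏ t, ‖M t‖ = ‖M s‖ * ((l₂ ++ l₁).map fun t => ‖M t‖).prod := by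
    rw [Fin.prod_univ_def, hl]
    simp only [List.map_append, List.map_cons, List.prod_append, List.prod_cons]
    ring
  have hX : ∀ t, ‖coordProj (S t) * M t‖ ≤ ‖M t‖ := fun t =>
    (norm_mul_le _ _).trans (mul_le_of_le_one_left (norm_nonneg _) (norm_coordProj_le _))
  have htr : (List.ofFn fun t => coordProj (S t) * M t).prod.trace =
      (coordProj (S s) *
        (M s * ((l₂ ++ l₁).map fun t => coordProj (S t) * M t).prod)).trace := by
    rw [List.ofFn_eq_map, hl]
    simp only [List.map_append, List.map_cons, List.prod_append, List.prod_cons]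
    rw [Matrix.trace_mul_comm]
    simp only [mul_assoc]
  rw [htr, hprod]
  refine (abs_trace_coordProj_mul_le _ _).trans ?_
  exact mul_le_mul_of_nonneg_left (norm_mul_list_prod_le _ _ hX _ _) (Nat.cast_nonneg _)

/-- A Hölder type inequality for traces of words in a fixed nonnegative diagonal matrix and
arbitrary matrices. -/
theorem abs_trace_prod_diagonal_mul_le {α : Fin d → ℝ} (hα : ∀ i, 0 ≤ α i) {N : ℕ} (hN : 0 < N)
    (M : Fin N → Matrix (Fin d) (Fin d) ℝ) :
    |(List.ofFn fun s => Matrix.diagonal α * M s).prod.trace| ≤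
      (∏ s, ‖M s‖) * ∑ i, α i ^ N := by
  obtain ⟨β, S, hβ, hS, hαβ⟩ := exists_antitone_layers α hα
  have hdiag : Matrix.diagonal α = ∑ j, β j • coordProj (S j) := by
    ext i i'
    rw [Matrix.sum_apply]
    by_cases h : i = i'
    · subst h
      simp [coordProj, hαβ i]
    · simp [coordProj, h]
  have hexp : (List.ofFn fun s => Matrix.diagonal α * M s).prod =
      ∑ r : Fin N → Fin d,
        (∏ s, β (r s)) • (List.ofFn fun s => coordProj (S (r s)) * M s).prod := by
    have h := (MultilinearMap.mkPiAlgebraFin ℝ N (Matrix (Fin d) (Fin d) ℝ)).map_sum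
      (fun s j => β j • (coordProj (S j) * M s))
    simp only [MultilinearMap.map_smul_univ, MultilinearMap.mkPiAlgebraFin_apply] at h
    rw [← h]
    simp only [hdiag, Finset.sum_mul, smul_mul_assoc]
  have hcard : ∀ r : Fin N → Fin d,
      |(List.ofFn fun s => coordProj (S (r s)) * M s).prod.trace| ≤
        (∑ i, ∏ s, if i ∈ S (r s) then (1 : ℝ) else 0) * ∏ s, ‖M s‖ := by
    intro r
    have : Nonempty (Fin N) := ⟨⟨0, hN⟩⟩
    -- The sets are nested, so the one with the largest index is the intersection of all of them,
    -- and its indicator is the product of the indicators.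
    obtain ⟨s₀, hs₀⟩ := Finite.exists_max r
    refine (abs_trace_prod_coordProj_mul_le (fun s => S (r s)) M s₀).trans
      (mul_le_mul_of_nonneg_right ?_ (Finset.prod_nonneg fun _ _ => norm_nonneg _))
    calc ((S (r s₀)).card : ℝ) = ∑ i ∈ S (r s₀), ∏ s, if i ∈ S (r s) then (1 : ℝ) else 0 := by
          rw [Finset.card_eq_sum_ones, Nat.cast_sum]
          refine Finset.sum_congr rfl fun i hi => ?_
          rw [Finset.prod_eq_one fun s _ => if_pos (hS (hs₀ s) hi), Nat.cast_one]
      _ ≤ ∑ i, ∏ s, if i ∈ S (r s) then (1 : ℝ) else 0 :=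
          Finset.sum_le_sum_of_subset_of_nonneg (Finset.subset_univ _) fun i _ _ =>
            Finset.prod_nonneg fun s _ => by split_ifs <;> norm_num
  rw [hexp, Matrix.trace_sum]
  refine (Finset.abs_sum_le_sum_abs _ _).trans ?_
  have hterm : ∀ r : Fin N → Fin d,
      |((∏ s, β (r s)) • (List.ofFn fun s => coordProj (S (r s)) * M s).prod).trace| ≤
        (∏ s, ‖M s‖) * ∑ i, ∏ s, if i ∈ S (r s) then β (r s) else 0 := by
    intro r
    have hb : 0 ≤ ∏ s, β (r s) := Finset.prod_nonneg fun _ _ => hβ _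
    rw [Matrix.trace_smul, smul_eq_mul, abs_mul, abs_of_nonneg hb]
    refine (mul_le_mul_of_nonneg_left (hcard r) hb).trans (le_of_eq ?_)
    have h : ∀ i, (∏ s, if i ∈ S (r s) then β (r s) else 0) =
        (∏ s, β (r s)) * ∏ s, if i ∈ S (r s) then (1 : ℝ) else 0 := fun i => by
      rw [← Finset.prod_mul_distrib]
      simp
    simp only [h, ← Finset.mul_sum]
    ring
  refine (Finset.sum_le_sum fun r _ => hterm r).trans (le_of_eq ?_)
  rw [← Finset.mul_sum, Finset.sum_comm]
  congr 1
  refine Finset.sum_congr rfl fun i _ => ?_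
  -- Summing over all choices of layers turns the product of indicators back into `(∑ j, β j 1[i ∈ S
  -- j]) ^ N = α i ^ N`.
  have h := Finset.prod_univ_sum (fun _ : Fin N => (Finset.univ : Finset (Fin d)))
    (fun _ j => if i ∈ S j then β j else 0)
  rw [Fintype.piFinset_univ] at h
  rw [← h, ← hαβ i]
  simp

theorem abs_trace_list_prod_diagonal_mul_le {α : Fin d → ℝ} (hα : ∀ i, 0 ≤ α i)
    {l : List (Matrix (Fin d) (Fin d) ℝ)} (hl : l ≠ []) :
    |(l.map fun M => Matrix.diagonal α * M).prod.trace| ≤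
      (l.map fun M => ‖M‖).prod * ∑ i, α i ^ l.length := by
  have h := abs_trace_prod_diagonal_mul_le hα (List.length_pos_iff.2 hl) (fun s => l[s])
  have h1 : (List.ofFn fun s : Fin l.length => Matrix.diagonal α * l[s]) =
      l.map fun M => Matrix.diagonal α * M := by
    apply List.ext_getElem <;> simp
  have h2 : ∏ s : Fin l.length, ‖l[s]‖ = (l.map fun M => ‖M‖).prod := by
    rw [← List.prod_ofFn]
    congr 1
    apply List.ext_getElem <;> simp
  rwa [h1, h2] at h

/-- Up to a cyclic shift, `(KᵀA)^j (AK)^j` is a word with exactly `2 * j` letters `A`, separated by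
`1` (where the two halves meet), copies of `K`, then `K Kᵀ` (where the ends meet) and copies of
`Kᵀ`. -/
theorem trace_transpose_pow_mul_pow_diagonal_mul_le {α : Fin d → ℝ} (hα : ∀ i, 0 ≤ α i)
    (K : Matrix (Fin d) (Fin d) ℝ) {j : ℕ} (hj : 1 ≤ j) :
    (((Matrix.diagonal α * K) ^ j).transpose * (Matrix.diagonal α * K) ^ j).trace ≤
      ‖K‖ ^ (2 * j) * ∑ i, α i ^ (2 * j) := by
  obtain ⟨i, rfl⟩ : ∃ i, j = i + 1 := ⟨j - 1, by omega⟩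
  set A := Matrix.diagonal α with hA
  have hAt : A.transpose = A := Matrix.diagonal_transpose α
  have hKt : ‖K.transpose‖ = ‖K‖ := by
    rw [← Matrix.conjTranspose_eq_transpose_of_trivial, Matrix.l2_opNorm_conjTranspose]
  set l : List (Matrix (Fin d) (Fin d) ℝ) :=
    [1] ++ List.replicate i K ++ [K * K.transpose] ++ List.replicate i K.transpose with hl
  have hlen : l.length = 2 * (i + 1) := by simp [hl]; ring
  have hpow : ∀ t : ℕ, (K.transpose * A) ^ (t + 1) = K.transpose * (A * K.transpose) ^ t * A := by
    intro t
    induction t with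
    | zero => simp
    | succ t ih => rw [pow_succ, ih, pow_succ]; simp only [mul_assoc]
  have htr : (((A * K) ^ (i + 1)).transpose * (A * K) ^ (i + 1)).trace =
      (l.map fun M => A * M).prod.trace := by
    rw [Matrix.transpose_pow, Matrix.transpose_mul, hAt, Matrix.trace_mul_comm, hpow,
      ← mul_assoc, Matrix.trace_mul_comm, pow_succ]
    simp [hl, mul_assoc]
  have hnorm : (l.map fun M => ‖M‖).prod ≤ ‖K‖ ^ (2 * (i + 1)) := by
    have h1 : ‖(1 : Matrix (Fin d) (Fin d) ℝ)‖ ≤ 1 := by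
      rw [← Matrix.diagonal_one, Matrix.l2_opNorm_diagonal, pi_norm_le_iff_of_nonneg zero_le_one]
      simp
    have h2 : ‖K * K.transpose‖ ≤ ‖K‖ * ‖K‖ := (norm_mul_le _ _).trans_eq (by rw [hKt])
    simp only [hl, List.map_append, List.map_cons, List.map_nil, List.map_replicate,
      List.prod_append, List.prod_cons, List.prod_nil, List.prod_replicate, mul_one, hKt]
    calc ‖(1 : Matrix (Fin d) (Fin d) ℝ)‖ * ‖K‖ ^ i * ‖K * K.transpose‖ * ‖K‖ ^ i
        ≤ 1 * ‖K‖ ^ i * (‖K‖ * ‖K‖) * ‖K‖ ^ i := by gcongr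
      _ = ‖K‖ ^ (2 * (i + 1)) := by ring
  have h := abs_trace_list_prod_diagonal_mul_le hα (l := l) (by simp [hl])
  rw [htr, ← hlen]
  refine (le_abs_self _).trans (h.trans ?_)
  rw [hlen]
  exact mul_le_mul_of_nonneg_right hnorm
    (Finset.sum_nonneg fun i _ => pow_nonneg (hα i) _)

/-- Conjugation by a unitary matrix preserves the trace. -/
theorem trace_conjStarAlgAut (U : unitary (Matrix (Fin d) (Fin d) ℝ))
    (M : Matrix (Fin d) (Fin d) ℝ) : (Unitary.conjStarAlgAut ℝ _ U M).trace = M.trace := by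
  rw [Unitary.conjStarAlgAut_apply, Matrix.trace_mul_comm, ← mul_assoc]
  simp

/-- Conjugation by a unitary matrix preserves the operator norm. -/
theorem norm_conjStarAlgAut (U : unitary (Matrix (Fin d) (Fin d) ℝ))
    (M : Matrix (Fin d) (Fin d) ℝ) : ‖Unitary.conjStarAlgAut ℝ _ U M‖ = ‖M‖ := by
  rw [Unitary.conjStarAlgAut_apply, ← Unitary.coe_star, CStarRing.norm_mul_coe_unitary,
    CStarRing.norm_coe_unitary_mul]

theorem trace_transpose_pow_mul_pow_le {α : Fin d → ℝ} (hα : ∀ i, 0 ≤ α i)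
    (U : unitary (Matrix (Fin d) (Fin d) ℝ)) (K : Matrix (Fin d) (Fin d) ℝ) {j : ℕ} (hj : 1 ≤ j) :
    (((Unitary.conjStarAlgAut ℝ _ U (Matrix.diagonal α) * K) ^ j).transpose *
        (Unitary.conjStarAlgAut ℝ _ U (Matrix.diagonal α) * K) ^ j).trace ≤
      ‖K‖ ^ (2 * j) * ∑ i, α i ^ (2 * j) := by
  set φ := Unitary.conjStarAlgAut ℝ (Matrix (Fin d) (Fin d) ℝ) U
  obtain ⟨K, rfl⟩ : ∃ K', φ K' = K := φ.surjective K
  have h := trace_transpose_pow_mul_pow_diagonal_mul_le hα K hj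
  rw [norm_conjStarAlgAut, ← map_mul, ← map_pow, ← Matrix.conjTranspose_eq_transpose_of_trivial,
    ← Matrix.star_eq_conjTranspose, ← map_star, ← map_mul, trace_conjStarAlgAut]
  rwa [← Matrix.conjTranspose_eq_transpose_of_trivial, ← Matrix.star_eq_conjTranspose] at h
end

/-! ### The chain of thought as gradient descent, and the average over the test weight -/

section
variable {d m : ℕ}

/-- The matrix whose columns are the given vectors. -/
def featureMat (x : Fin m → EuclideanSpace ℝ (Fin d)) : Matrix (Fin d) (Fin m) ℝ :=
  Matrix.of fun a j => x j a

/-- The empirical second moment matrix of a family of vectors. -/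
noncomputable def sampleCov (x : Fin m → EuclideanSpace ℝ (Fin d)) : Matrix (Fin d) (Fin d) ℝ :=
  (m : ℝ)⁻¹ • (featureMat x * (featureMat x).transpose)

/-- The last column of `Eᵀ W E` holds `c` times the least squares residuals on the data columns. `V
E` is `-c⁻¹ Γ⁻¹ X` there and vanishes on the chain columns, so `c` cancels and only the latest link
matters. -/
theorem nextLink_eq {c : ℝ} (hc : c ≠ 0) (n : ℕ) (Λ : Matrix (Fin d) (Fin d) ℝ)
    (x : Fin m → EuclideanSpace ℝ (Fin d)) (w : EuclideanSpace ℝ (Fin d))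
    {i : ℕ} (u : Fin (i + 1) → EuclideanSpace ℝ (Fin d)) :
    nextLink c n Λ x w u - w = WithLp.toLp 2
      ((1 - (gammaMat n Λ)⁻¹ * sampleCov x).mulVec (u (Fin.last i) - w).ofLp) := by
  have hres : ∀ j : Fin m, (Matrix.transpose (embedding x w u) * trainedW d c * embedding x w u)
      (Sum.inl j) (Sum.inr (Fin.last i)) =
        c * ((featureMat x).transpose.mulVec (u (Fin.last i) - w).ofLp) j := by
    intro j
    simp [embedding, trainedW, Matrix.fromBlocks_transpose, Matrix.fromBlocks_multiply,
      Matrix.mul_apply, Matrix.mulVec, dotProduct, featureMat, Matrix.one_apply,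
      PiLp.inner_apply, mul_sub, Finset.mul_sum, Finset.sum_sub_distrib]
    ring_nf
    simp only [Finset.mul_sum, neg_add_eq_sub]
    congr 1 <;> exact Finset.sum_congr rfl fun _ _ => by ring
  have hVE : ∀ (a : Fin d) (j : Fin m), (trainedV c n Λ * embedding x w u)
      (Sum.inr (Sum.inl a)) (Sum.inl j) = -(c⁻¹ * ((gammaMat n Λ)⁻¹ * featureMat x) a j) := by
    intro a j
    simp [embedding, trainedV, Matrix.mul_apply, featureMat,
      Finset.mul_sum, mul_assoc]
  have hVE' : ∀ (a : Fin d) (j : Fin (i + 1)), (trainedV c n Λ * embedding x w u)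
      (Sum.inr (Sum.inl a)) (Sum.inr j) = 0 := by
    intro a j
    simp [embedding, trainedV, Matrix.fromBlocks_multiply]
  have hmv : ∀ (v : Fin d → ℝ) (a : Fin d), ((gammaMat n Λ)⁻¹ * sampleCov x).mulVec v a =
      (m : ℝ)⁻¹ * ∑ j, ((gammaMat n Λ)⁻¹ * featureMat x) a j *
        (featureMat x).transpose.mulVec v j := by
    intro v a
    rw [sampleCov, Matrix.mul_smul, Matrix.smul_mulVec, ← Matrix.mul_assoc,
      ← Matrix.mulVec_mulVec]
    rfl
  ext a
  have hE : embedding x w u (Sum.inr (Sum.inl a)) (Sum.inr (Fin.last i)) = u (Fin.last i) a := by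
    simp [embedding]
  have hlsa : nextLink c n Λ x w u a = u (Fin.last i) a -
      ((gammaMat n Λ)⁻¹ * sampleCov x).mulVec (u (Fin.last i) - w).ofLp a := by
    change lsa (m : ℝ) (trainedV c n Λ) (trainedW d c) (embedding x w u)
      (Sum.inr (Sum.inl a)) (Sum.inr (Fin.last i)) = _
    rw [lsa, Matrix.add_apply, hE, Matrix.mul_apply, Fintype.sum_sum_type]
    simp only [hVE, hVE', Matrix.smul_apply, hres, zero_mul, Finset.sum_const_zero, add_zero,
      smul_eq_mul]
    rw [hmv, Finset.mul_sum, sub_eq_add_neg _ (∑ j, _), ← Finset.sum_neg_distrib]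
    congr 1
    refine Finset.sum_congr rfl fun j _ => ?_
    field_simp
  rw [PiLp.sub_apply, hlsa]
  simp [Matrix.sub_mulVec]
  ring

theorem cotEstimate_sub_eq {c : ℝ} (hc : c ≠ 0) (n : ℕ) (Λ : Matrix (Fin d) (Fin d) ℝ)
    (x : Fin m → EuclideanSpace ℝ (Fin d)) (w : EuclideanSpace ℝ (Fin d)) (j : ℕ) :
    cotEstimate c n Λ x w j - w = WithLp.toLp 2
      (-((1 - (gammaMat n Λ)⁻¹ * sampleCov x) ^ j).mulVec w.ofLp) := by
  induction j with
  | zero => ext a; simp [cotEstimate, cotChain]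
  | succ j ih =>
    have h : cotEstimate c n Λ x w (j + 1) = nextLink c n Λ x w (cotChain c n Λ x w j) := by
      simp [cotEstimate, cotChain]
    rw [h, nextLink_eq hc]
    change WithLp.toLp 2 (Matrix.mulVec _ (cotEstimate c n Λ x w j - w).ofLp) = _
    rw [ih, pow_succ', ← Matrix.mulVec_mulVec, Matrix.mulVec_neg]

theorem integral_sq_inner_stdGaussian (v : EuclideanSpace ℝ (Fin d)) :
    Integrable (fun w => (inner ℝ v w) ^ 2) (stdGaussian (EuclideanSpace ℝ (Fin d))) ∧
    ∫ w, (inner ℝ v w) ^ 2 ∂(stdGaussian (EuclideanSpace ℝ (Fin d))) = ‖v‖ ^ 2 := by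
  set L : StrongDual ℝ (EuclideanSpace ℝ (Fin d)) := innerSL ℝ v with hL
  have hmem : MemLp L 2 (stdGaussian (EuclideanSpace ℝ (Fin d))) :=
    IsGaussian.memLp_dual _ L 2 (by simp)
  refine ⟨hmem.integrable_sq, ?_⟩
  have h := variance_dual_stdGaussian L
  rw [variance_of_integral_eq_zero hmem.aestronglyMeasurable.aemeasurable
    (integral_strongDual_stdGaussian L), hL, innerSL_apply_norm] at h
  exact h

theorem lintegral_norm_sq_mulVec (M : Matrix (Fin d) (Fin d) ℝ) :
    ∫⁻ w, ENNReal.ofReal (‖(WithLp.toLp 2 (-(M.mulVec w.ofLp)) : EuclideanSpace ℝ (Fin d))‖ ^ 2)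
        ∂(multivariateGaussian 0 (1 : Matrix (Fin d) (Fin d) ℝ)) =
      ENNReal.ofReal (M.transpose * M).trace := by
  rw [multivariateGaussian_zero_one]
  have h1 : ∀ w : EuclideanSpace ℝ (Fin d),
      ‖(WithLp.toLp 2 (-(M.mulVec w.ofLp)) : EuclideanSpace ℝ (Fin d))‖ ^ 2 =
        ∑ a, (inner ℝ (WithLp.toLp 2 (M a) : EuclideanSpace ℝ (Fin d)) w) ^ 2 := by
    intro w
    rw [EuclideanSpace.real_norm_sq_eq]
    refine Finset.sum_congr rfl fun a _ => ?_
    simp [Matrix.mulVec, dotProduct, PiLp.inner_apply, mul_comm]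
  simp only [h1]
  rw [← ofReal_integral_eq_lintegral_ofReal
    (integrable_finsetSum _ fun a _ => (integral_sq_inner_stdGaussian _).1)
    (ae_of_all _ fun w => Finset.sum_nonneg fun a _ => sq_nonneg _),
    integral_finsetSum _ fun a _ => (integral_sq_inner_stdGaussian _).1]
  congr 1
  simp only [(integral_sq_inner_stdGaussian _).2, EuclideanSpace.real_norm_sq_eq]
  simp only [Matrix.trace, Matrix.diag, Matrix.mul_apply, Matrix.transpose_apply]
  rw [Finset.sum_comm]
  simp [sq]

/-! ### Sampling noise as a multiplicative perturbation -/

/-- Simultaneous diagonalization of `1 - Γ⁻¹ Λ`, which is a left factor of `Γ⁻¹`. -/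
theorem exists_factorization_gammaMat {Λ : Matrix (Fin d) (Fin d) ℝ} (hΛ : Λ.IsHermitian)
    {a : ℝ} (ha : 0 < a) (hd : 1 ≤ d) {n : ℕ} (hn : 1 ≤ n) (hle : ∀ i, a ≤ hΛ.eigenvalues i) :
    ∃ (U : unitary (Matrix (Fin d) (Fin d) ℝ)) (α : Fin d → ℝ) (P : Matrix (Fin d) (Fin d) ℝ),
      (∀ i, 0 ≤ α i) ∧ (∀ i, α i ≤ 1) ∧
      1 - (gammaMat n Λ)⁻¹ * Λ = Unitary.conjStarAlgAut ℝ _ U (Matrix.diagonal α) ∧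
      (1 - (gammaMat n Λ)⁻¹ * Λ) * P = (gammaMat n Λ)⁻¹ ∧ ‖P‖ ≤ (n : ℝ) / d / a := by
  set U := hΛ.eigenvectorUnitary
  set φ := Unitary.conjStarAlgAut ℝ (Matrix (Fin d) (Fin d) ℝ) U with hφ
  set lam := hΛ.eigenvalues with hlam
  have hΛφ : Λ = φ (Matrix.diagonal lam) := hΛ.spectral_theorem
  have hd' : (0 : ℝ) < d := by exact_mod_cast hd
  have hn' : (0 : ℝ) < n := by exact_mod_cast hn
  have hlpos : ∀ i, 0 < lam i := fun i => ha.trans_le (hle i)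
  set t := Λ.trace with ht
  have htd : d * a ≤ t := by
    have h : t = ∑ i, lam i := by
      rw [ht, hΛ.trace_eq_sum_eigenvalues]; rfl
    rw [h]
    have := Finset.card_nsmul_le_sum Finset.univ lam a fun i _ => hle i
    simpa using this
  have htpos : 0 < t := lt_of_lt_of_le (by positivity) htd
  set γ : Fin d → ℝ := fun i => (1 + 1 / (n : ℝ)) * lam i + 1 / (n : ℝ) * t with hγ
  have hγpos : ∀ i, 0 < γ i := fun i => by have := hlpos i; positivity
  have hΓ : gammaMat n Λ = φ (Matrix.diagonal γ) := by
    have h : Matrix.diagonal γ = (1 + 1 / (n : ℝ)) • Matrix.diagonal lam +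
        (1 / (n : ℝ) * t) • (1 : Matrix (Fin d) (Fin d) ℝ) := by
      rw [← Matrix.diagonal_one, ← Matrix.diagonal_smul, ← Matrix.diagonal_smul,
        Matrix.diagonal_add]
      congr 1
      ext i
      simp [hγ]
    rw [h, map_add, map_smul, map_smul, map_one, ← hΛφ, gammaMat]
  have hΓinv : (gammaMat n Λ)⁻¹ = φ (Matrix.diagonal fun i => (γ i)⁻¹) := by
    apply Matrix.inv_eq_left_inv
    rw [hΓ, ← map_mul, Matrix.diagonal_mul_diagonal]
    simp [(hγpos _).ne', -Unitary.conjStarAlgAut_apply]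
  have hA : 1 - (gammaMat n Λ)⁻¹ * Λ = φ (Matrix.diagonal fun i => 1 - (γ i)⁻¹ * lam i) := by
    conv_lhs => rw [hΓinv, hΛφ, ← map_mul, Matrix.diagonal_mul_diagonal, ← map_one φ, ← map_sub,
      ← Matrix.diagonal_one, Matrix.diagonal_sub]
  have hlγ : ∀ i, lam i ≤ γ i := fun i => by
    have h1 : 0 ≤ 1 / (n : ℝ) * lam i := by have := hlpos i; positivity
    have h2 : 0 ≤ 1 / (n : ℝ) * t := by positivity
    simp only [hγ]
    linarith
  -- With `t` the trace, `1 - λ/γ = (λ + t)/(n γ)`, which forces `P` to have eigenvalues `n/(λ +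
  -- t)`; they are at most `n/(d a)` because `t ≥ d a`.
  refine ⟨U, fun i => 1 - (γ i)⁻¹ * lam i, φ (Matrix.diagonal fun i => n / (lam i + t)),
    ?_, ?_, hA, ?_, ?_⟩
  · intro i
    rw [sub_nonneg, inv_mul_le_one₀ (hγpos i)]
    exact hlγ i
  · intro i
    have := mul_nonneg (inv_nonneg.2 (hγpos i).le) (hlpos i).le
    linarith
  · rw [hA, hΓinv, ← map_mul, Matrix.diagonal_mul_diagonal]
    congr 2
    ext i
    have h1 := (hγpos i).ne'
    have h2 : lam i + t ≠ 0 := by have := hlpos i; positivity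
    field_simp
    simp only [hγ]
    field_simp
    ring
  · rw [norm_conjStarAlgAut, Matrix.l2_opNorm_diagonal,
      pi_norm_le_iff_of_nonneg (by positivity)]
    intro i
    have h := hlpos i
    rw [Real.norm_of_nonneg (by positivity), div_div]
    exact div_le_div_of_nonneg_left hn'.le (by positivity) (by linarith)

/-- After the factorization and the trace inequality, both exponents equal `2 * j`. Since `α ≤ 1`,
the power of `α` may be lowered to `2 * k`; the noise factor is at least one, so its power may be
raised to `4 * k`. This treats `j = k` and `j = k + 1` together. -/
theorem trace_transpose_pow_mul_pow_residual_le {Λ : Matrix (Fin d) (Fin d) ℝ}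
    (hΛ : Λ.IsHermitian) {a : ℝ} (ha : 0 < a) (hd : 1 ≤ d) {n : ℕ} (hn : 1 ≤ n)
    (hle : ∀ i, a ≤ hΛ.eigenvalues i) (S : Matrix (Fin d) (Fin d) ℝ) {j k : ℕ} (hk : 1 ≤ k)
    (hkj : k ≤ j) (hjk : j ≤ 2 * k) :
    (((1 - (gammaMat n Λ)⁻¹ * S) ^ j).transpose * (1 - (gammaMat n Λ)⁻¹ * S) ^ j).trace ≤
      ((1 - (gammaMat n Λ)⁻¹ * Λ) ^ (2 * k)).trace * (1 + n / d / a * ‖Λ - S‖) ^ (4 * k) := by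
  obtain ⟨U, α, P, hα0, hα1, hA, hAP, hP⟩ := exists_factorization_gammaMat hΛ ha hd hn hle
  have hB : 1 - (gammaMat n Λ)⁻¹ * S =
      (1 - (gammaMat n Λ)⁻¹ * Λ) * (1 + P * (Λ - S)) := by
    rw [mul_add, mul_one, ← mul_assoc, hAP, mul_sub]
    abel
  have htr : ((1 - (gammaMat n Λ)⁻¹ * Λ) ^ (2 * k)).trace = ∑ i, α i ^ (2 * k) := by
    rw [hA, ← map_pow, trace_conjStarAlgAut, Matrix.diagonal_pow, Matrix.trace_diagonal]
    rfl
  have hK : ‖1 + P * (Λ - S)‖ ≤ 1 + n / d / a * ‖Λ - S‖ := by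
    refine (norm_add_le _ _).trans (add_le_add ?_ ?_)
    · rw [← Matrix.diagonal_one, Matrix.l2_opNorm_diagonal,
        pi_norm_le_iff_of_nonneg zero_le_one]
      simp
    · exact (norm_mul_le _ _).trans (mul_le_mul_of_nonneg_right hP (norm_nonneg _))
  have h1 : 1 ≤ 1 + n / d / a * ‖Λ - S‖ := by
    have : 0 ≤ n / d / a * ‖Λ - S‖ := by positivity
    linarith
  rw [htr, hB]
  conv_lhs => rw [hA]
  refine (trace_transpose_pow_mul_pow_le hα0 U _ (hk.trans hkj)).trans ?_
  rw [mul_comm]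
  refine mul_le_mul ?_ ?_ (by positivity)
    (Finset.sum_nonneg fun i _ => pow_nonneg (hα0 i) _)
  · exact Finset.sum_le_sum fun i _ => pow_le_pow_of_le_one (hα0 i) (hα1 i) (by omega)
  · exact (pow_le_pow_left₀ (norm_nonneg _) hK _).trans (pow_le_pow_right₀ h1 (by omega))
end

/-! ### Exponential moments of Gaussian quadratic forms -/

theorem exp_sub_sq_le {x : ℝ} (h : |x| ≤ 1 / 2) : Real.exp (x - x ^ 2) ≤ 1 + x := by
  obtain ⟨h1, h2⟩ := abs_le.1 h
  have hpos : 0 < 1 + x := by linarith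
  have key : 1 ≤ (1 + x) * Real.exp (x ^ 2 - x) := by
    -- For `x ≥ 0` first order suffices: `(1 + x)(1 - x + x ^ 2) = 1 + x ^ 3`. For `x ≤ 0` the cubic
    -- term is negative and the second order term of the exponential makes up for it.
    rcases le_total 0 x with hx | hx
    · have := Real.add_one_le_exp (x ^ 2 - x)
      calc 1 ≤ (1 + x) * (x ^ 2 - x + 1) := by nlinarith [pow_nonneg hx 3]
        _ ≤ _ := by gcongr
    · have := Real.quadratic_le_exp_of_nonneg (x := x ^ 2 - x) (by nlinarith)
      calc 1 ≤ (1 + x) * (1 + (x ^ 2 - x) + (x ^ 2 - x) ^ 2 / 2) := by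
            have h3 : (1 + x) * (1 + (x ^ 2 - x) + (x ^ 2 - x) ^ 2 / 2) =
              1 + x ^ 2 * ((1 + x) * (1 - x ^ 2 + x ^ 2) + x ^ 2 * (x - 1)) / 2 := by ring
            rw [h3]
            nlinarith [sq_nonneg x, mul_nonneg (sq_nonneg x) (sq_nonneg x),
              mul_nonneg (sq_nonneg x) (by nlinarith : 0 ≤ (1 + x) * (1 - x ^ 2 + x ^ 2)
                + x ^ 2 * (x - 1))]
        _ ≤ _ := by gcongr
  have h3 : x - x ^ 2 = -(x ^ 2 - x) := by ring
  rw [h3, Real.exp_neg, inv_le_iff_one_le_mul₀ (Real.exp_pos _)]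
  exact key

/-- The Gaussian integral equals `exp (-tv) / √(1 - 2tv)`; the condition on `t` allows
`exp_sub_sq_le` at `x = -2tv`. -/
theorem exp_sq_sub_var_gaussianReal (v : ℝ≥0) {t : ℝ} (ht : |t| * v ≤ 1 / 4) :
    Integrable (fun g => Real.exp (t * (g ^ 2 - v))) (gaussianReal 0 v) ∧
    ∫ g, Real.exp (t * (g ^ 2 - v)) ∂(gaussianReal 0 v) ≤ Real.exp (2 * t ^ 2 * v ^ 2) := by
  by_cases hv : v = 0
  · subst hv
    rw [gaussianReal_zero_var]
    refine ⟨integrable_dirac (by simp), ?_⟩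
    simp
  have hv' : (0 : ℝ) < v := by positivity
  have hs : |t * v| ≤ 1 / 4 := by rwa [abs_mul, abs_of_pos hv']
  obtain ⟨hs1, hs2⟩ := abs_le.1 hs
  have hb : 0 < (2 * (v : ℝ))⁻¹ - t := by
    have h : (2 * (v : ℝ))⁻¹ - t = (1 - 2 * (t * v)) / (2 * v) := by field_simp
    rw [h]
    exact div_pos (by linarith) (by linarith)
  have hfun : ∀ g : ℝ, gaussianPDFReal 0 v g * Real.exp (t * (g ^ 2 - v)) =
      ((√(2 * Real.pi * v))⁻¹ * Real.exp (-(t * v))) *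
        Real.exp (-((2 * (v : ℝ))⁻¹ - t) * g ^ 2) := by
    intro g
    rw [gaussianPDFReal, mul_assoc, mul_assoc (√(2 * Real.pi * v))⁻¹, ← Real.exp_add,
      ← Real.exp_add]
    congr 2
    field_simp
    ring
  constructor
  · rw [gaussianReal_of_var_ne_zero 0 hv, integrable_withDensity_iff_integrable_smul₀'
      (measurable_gaussianPDF 0 v).aemeasurable (ae_of_all _ fun _ => gaussianPDF_lt_top)]
    simp only [toReal_gaussianPDF, smul_eq_mul, hfun]
    exact (integrable_exp_neg_mul_sq hb).const_mul _
  · rw [integral_gaussianReal_eq_integral_smul hv]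
    simp only [smul_eq_mul, hfun]
    rw [integral_const_mul, integral_gaussian]
    have hs3 : 0 < 1 - 2 * (t * v) := by linarith
    have h1 : Real.pi / ((2 * (v : ℝ))⁻¹ - t) = (2 * Real.pi * v) / (1 - 2 * (t * v)) := by
      have h : (2 * (v : ℝ))⁻¹ - t = (1 - 2 * (t * v)) / (2 * v) := by field_simp
      rw [h]
      field_simp
    have h2 : 0 < √(2 * Real.pi * v) := Real.sqrt_pos.2 (by positivity)
    have h3 : 0 < √(1 - 2 * (t * v)) := Real.sqrt_pos.2 hs3
    have h4 : Real.exp (-(t * v) - 2 * t ^ 2 * v ^ 2) ≤ √(1 - 2 * (t * v)) := by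
      apply Real.le_sqrt_of_sq_le
      rw [← Real.exp_nat_mul]
      have := exp_sub_sq_le (x := -(2 * (t * v))) (by rw [abs_neg, abs_mul]; norm_num; linarith)
      calc _ = Real.exp (-(2 * (t * v)) - (-(2 * (t * v))) ^ 2) := by
            congr 1; push_cast; ring
        _ ≤ _ := this.trans_eq (by ring)
    rw [h1, Real.sqrt_div (by positivity)]
    calc _ = Real.exp (-(t * v)) / √(1 - 2 * (t * v)) := by field_simp
      _ ≤ _ := by
        rw [div_le_iff₀ h3]
        calc Real.exp (-(t * v)) = Real.exp (2 * t ^ 2 * v ^ 2) *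
              Real.exp (-(t * v) - 2 * t ^ 2 * v ^ 2) := by rw [← Real.exp_add]; congr 1; ring
          _ ≤ _ := by gcongr

section
variable {d m : ℕ}

theorem map_inner_multivariateGaussian {Λ : Matrix (Fin d) (Fin d) ℝ} (hΛ : Λ.PosSemidef)
    (u : EuclideanSpace ℝ (Fin d)) :
    (multivariateGaussian 0 Λ).map (fun x => inner ℝ u x) =
      gaussianReal 0 (u.ofLp ⬝ᵥ Λ.mulVec u.ofLp).toNNReal := by
  have h := IsGaussian.map_eq_gaussianReal (μ := multivariateGaussian 0 Λ) (innerSL ℝ u)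
  have h1 : Var[innerSL ℝ u; multivariateGaussian 0 Λ] = u.ofLp ⬝ᵥ Λ.mulVec u.ofLp := by
    rw [← covarianceBilin_multivariateGaussian (μ := 0) hΛ u u,
      covarianceBilin_self IsGaussian.memLp_two_id]
    rfl
  rw [ContinuousLinearMap.integral_comp_id_comm, integral_id_multivariateGaussian, h1] at h
  · simpa using h
  · exact IsGaussian.integrable_id

/-- The quadratic form of a matrix. -/
def quadForm (M : Matrix (Fin d) (Fin d) ℝ) (u : EuclideanSpace ℝ (Fin d)) : ℝ :=
  u.ofLp ⬝ᵥ M.mulVec u.ofLp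

theorem quadForm_eq_inner (M : Matrix (Fin d) (Fin d) ℝ) (u : EuclideanSpace ℝ (Fin d)) :
    quadForm M u = inner ℝ u (Matrix.toEuclideanCLM (𝕜 := ℝ) M u) :=
  (Matrix.inner_toEuclideanCLM M u u).symm

theorem quadForm_sampleCov (x : Fin m → EuclideanSpace ℝ (Fin d))
    (u : EuclideanSpace ℝ (Fin d)) :
    quadForm (sampleCov x) u = (m : ℝ)⁻¹ * ∑ j, (inner ℝ u (x j)) ^ 2 := by
  have h : ∀ j, (featureMat x).transpose.mulVec u.ofLp j = inner ℝ u (x j) := fun j => by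
    simp [Matrix.mulVec, dotProduct, featureMat, PiLp.inner_apply]
  rw [quadForm, sampleCov, Matrix.smul_mulVec, dotProduct_smul, ← Matrix.mulVec_mulVec,
    Matrix.dotProduct_mulVec, ← Matrix.mulVec_transpose, smul_eq_mul, dotProduct]
  simp only [h, sq]

theorem quadForm_sub (M N : Matrix (Fin d) (Fin d) ℝ) (u : EuclideanSpace ℝ (Fin d)) :
    quadForm (M - N) u = quadForm M u - quadForm N u := by
  simp [quadForm, Matrix.sub_mulVec, dotProduct_sub]

theorem abs_quadForm_le (M : Matrix (Fin d) (Fin d) ℝ) (u : EuclideanSpace ℝ (Fin d)) :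
    |quadForm M u| ≤ ‖M‖ * ‖u‖ ^ 2 := by
  rw [quadForm_eq_inner]
  refine (abs_real_inner_le_norm _ _).trans ?_
  have h := (Matrix.toEuclideanCLM (𝕜 := ℝ) M).le_opNorm u
  rw [← Matrix.cstar_norm_def] at h
  nlinarith [norm_nonneg u]

/-- The form is `-1/m` times a sum of `m` independent centred squares of Gaussians of variance `v ≤
b`, so the expectation factors into scalar ones at `t = -θ/m`. -/
theorem lintegral_exp_quadForm_le {Λ : Matrix (Fin d) (Fin d) ℝ} (hΛ : Λ.PosSemidef) {b : ℝ}
    (hb : ‖Λ‖ ≤ b) (hm : 1 ≤ m) {u : EuclideanSpace ℝ (Fin d)} (hu : ‖u‖ ≤ 1) {θ : ℝ}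
    (hθ : |θ| * b ≤ m / 4) :
    ∫⁻ x, ENNReal.ofReal (Real.exp (θ * quadForm (Λ - sampleCov x) u))
        ∂(Measure.pi fun _ : Fin m => multivariateGaussian 0 Λ) ≤
      ENNReal.ofReal (Real.exp (2 * θ ^ 2 * b ^ 2 / m)) := by
  have hm' : (0 : ℝ) < m := by exact_mod_cast hm
  set v : ℝ≥0 := (quadForm Λ u).toNNReal with hv
  have hv0 : (v : ℝ) = quadForm Λ u := by
    refine Real.coe_toNNReal _ ?_
    simpa [quadForm] using hΛ.dotProduct_mulVec_nonneg u.ofLp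
  have hvb : (v : ℝ) ≤ b := by
    rw [hv0]
    refine (le_abs_self _).trans ((abs_quadForm_le _ _).trans ?_)
    calc ‖Λ‖ * ‖u‖ ^ 2 ≤ ‖Λ‖ * 1 := by gcongr; exact pow_le_one₀ (norm_nonneg _) hu
      _ ≤ b := by simpa using hb
  have hb0 : 0 ≤ b := v.2.trans hvb
  set t : ℝ := -θ / m with ht
  have htv : |t| * v ≤ 1 / 4 := by
    rw [ht, abs_div, abs_neg, abs_of_pos hm', div_mul_eq_mul_div, div_le_iff₀ hm']
    nlinarith [mul_le_mul_of_nonneg_left hvb (abs_nonneg θ)]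
  obtain ⟨hint, hle⟩ := exp_sq_sub_var_gaussianReal v htv
  have hmap := map_inner_multivariateGaussian hΛ u
  change _ = gaussianReal 0 v at hmap
  have hmeas : Measurable fun x : EuclideanSpace ℝ (Fin d) => (inner ℝ u x : ℝ) := by fun_prop
  rw [← hmap] at hint hle
  rw [integral_map hmeas.aemeasurable (by fun_prop)] at hle
  replace hint : Integrable (fun x => Real.exp (t * ((inner ℝ u x) ^ 2 - v)))
      (multivariateGaussian 0 Λ) := hint.comp_measurable hmeas
  have hfun : ∀ x : Fin m → EuclideanSpace ℝ (Fin d),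
      Real.exp (θ * quadForm (Λ - sampleCov x) u) =
        ∏ j, Real.exp (t * ((inner ℝ u (x j)) ^ 2 - v)) := by
    intro x
    rw [← Real.exp_sum, quadForm_sub, quadForm_sampleCov, ← hv0, ← Finset.mul_sum,
      Finset.sum_sub_distrib]
    congr 1
    simp only [Finset.sum_const, Finset.card_univ, Fintype.card_fin, nsmul_eq_mul, ht]
    field_simp
    ring
  simp only [hfun]
  rw [← ofReal_integral_eq_lintegral_ofReal (Integrable.fintype_prod fun _ => hint)
    (ae_of_all _ fun x => Finset.prod_nonneg fun j _ => (Real.exp_pos _).le),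
    integral_fintype_prod_eq_prod (fun (_ : Fin m) (y : EuclideanSpace ℝ (Fin d)) =>
      Real.exp (t * ((inner ℝ u y) ^ 2 - v)))]
  refine ENNReal.ofReal_le_ofReal ?_
  calc _ ≤ ∏ _j : Fin m, Real.exp (2 * t ^ 2 * v ^ 2) :=
        Finset.prod_le_prod (fun _ _ => integral_nonneg fun _ => (Real.exp_pos _).le)
          fun _ _ => hle
    _ = Real.exp (2 * θ ^ 2 * v ^ 2 / m) := by
        rw [Finset.prod_const, ← Real.exp_nat_mul, Finset.card_univ, Fintype.card_fin, ht]
        congr 1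
        field_simp
    _ ≤ _ := by gcongr

/-! ### Operator norm deviation of the sample covariance -/

theorem exists_abs_quadForm_ge [NeZero d] {M : Matrix (Fin d) (Fin d) ℝ} (hM : M.IsHermitian) :
    ∃ v : EuclideanSpace ℝ (Fin d), ‖v‖ = 1 ∧
      ∀ u ∈ Metric.ball ((3 / 4 : ℝ) • v) (1 / 4), ‖M‖ ≤ 8 * |quadForm M u| := by
  obtain ⟨i, hi⟩ := Finite.exists_max fun i => |hM.eigenvalues i|
  set v := hM.eigenvectorBasis i with hv
  set μ := hM.eigenvalues i with hμ
  have hv1 : ‖v‖ = 1 := hM.eigenvectorBasis.orthonormal.1 i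
  have hnorm : ‖M‖ ≤ |μ| := by
    conv_lhs => rw [hM.spectral_theorem]
    rw [norm_conjStarAlgAut, Matrix.l2_opNorm_diagonal, pi_norm_le_iff_of_nonneg (abs_nonneg _)]
    exact fun j => hi j
  have hMv : M.mulVec v.ofLp = μ • v.ofLp := hM.mulVec_eigenvectorBasis i
  refine ⟨v, hv1, fun u hu => ?_⟩
  obtain ⟨e, rfl⟩ : ∃ e, (3 / 4 : ℝ) • v + e = u := ⟨u - (3 / 4 : ℝ) • v, by abel⟩
  have he : ‖e‖ ≤ 1 / 4 := by
    have := Metric.mem_ball.1 hu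
    rw [dist_eq_norm, add_sub_cancel_left] at this
    exact this.le
  have hvv : v.ofLp ⬝ᵥ v.ofLp = 1 := by
    have h : (inner ℝ v v : ℝ) = 1 := by rw [real_inner_self_eq_norm_sq, hv1]; norm_num
    rwa [EuclideanSpace.inner_eq_star_dotProduct, star_trivial] at h
  have hve : |v.ofLp ⬝ᵥ e.ofLp| ≤ 1 / 4 := by
    have h := abs_real_inner_le_norm e v
    rw [hv1, mul_one] at h
    simpa [EuclideanSpace.inner_eq_star_dotProduct] using h.trans he
  have hMt : M.transpose = M := by
    rw [← Matrix.conjTranspose_eq_transpose_of_trivial]; exact hM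
  have hq : quadForm M ((3 / 4 : ℝ) • v + e) =
      μ * (9 / 16 + 3 / 2 * (v.ofLp ⬝ᵥ e.ofLp)) + quadForm M e := by
    have h1 : v.ofLp ⬝ᵥ M.mulVec e.ofLp = μ * (v.ofLp ⬝ᵥ e.ofLp) := by
      rw [Matrix.dotProduct_mulVec, ← Matrix.mulVec_transpose, hMt, hMv, smul_dotProduct,
        smul_eq_mul]
    simp only [quadForm, WithLp.ofLp_add, WithLp.ofLp_smul, Matrix.mulVec_add, Matrix.mulVec_smul,
      hMv, dotProduct_add, add_dotProduct, smul_dotProduct, dotProduct_smul, smul_eq_mul, hvv, h1,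
      dotProduct_comm e.ofLp v.ofLp]
    ring
  have he2 : |quadForm M e| ≤ |μ| / 16 := by
    refine (abs_quadForm_le M e).trans ?_
    have : ‖e‖ ^ 2 ≤ (1 / 4) ^ 2 := pow_le_pow_left₀ (norm_nonneg _) he 2
    nlinarith [norm_nonneg M]
  -- In the worst case `9/16 - 3/2 * 1/4 = 3/16`; the term quadratic in `e` takes away at most
  -- `1/16`, leaving `|μ| / 8`.
  have h1 : |μ| * (3 / 16) ≤ |μ * (9 / 16 + 3 / 2 * (v.ofLp ⬝ᵥ e.ofLp))| := by
    rw [abs_mul]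
    gcongr
    refine le_trans ?_ (le_abs_self _)
    linarith [(abs_le.1 hve).1]
  have h2 := abs_sub_abs_le_abs_sub (μ * (9 / 16 + 3 / 2 * (v.ofLp ⬝ᵥ e.ofLp))) (-quadForm M e)
  rw [abs_neg, sub_neg_eq_add, ← hq] at h2
  linarith
end

section
variable {d m : ℕ}

theorem continuous_featureMat :
    Continuous (featureMat : (Fin m → EuclideanSpace ℝ (Fin d)) → Matrix (Fin d) (Fin m) ℝ) := by
  refine continuous_matrix fun a j => ?_
  simp only [featureMat, Matrix.of_apply]
  fun_prop

theorem continuous_sampleCov :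
    Continuous (sampleCov : (Fin m → EuclideanSpace ℝ (Fin d)) → Matrix (Fin d) (Fin d) ℝ) :=
  (continuous_featureMat.matrix_mul continuous_featureMat.matrix_transpose).const_smul (m : ℝ)⁻¹

theorem isHermitian_sampleCov (x : Fin m → EuclideanSpace ℝ (Fin d)) :
    (sampleCov x).IsHermitian := by
  rw [Matrix.IsHermitian, Matrix.conjTranspose_eq_transpose_of_trivial, sampleCov,
    Matrix.transpose_smul, Matrix.transpose_mul, Matrix.transpose_transpose]

theorem continuous_quadForm :
    Continuous fun p : Matrix (Fin d) (Fin d) ℝ × EuclideanSpace ℝ (Fin d) =>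
      quadForm p.1 p.2 := by
  unfold quadForm
  refine Continuous.dotProduct ?_ (Continuous.matrix_mulVec continuous_fst ?_) <;> fun_prop

/-- The exponential of the norm of a symmetric matrix is controlled by the average over the unit
ball of the exponential of its quadratic form. -/
theorem exp_norm_mul_volume_ball_le [NeZero d] {M : Matrix (Fin d) (Fin d) ℝ}
    (hM : M.IsHermitian) {θ : ℝ} (hθ : 0 ≤ θ) :
    ENNReal.ofReal (Real.exp (θ * ‖M‖)) *
        volume (Metric.ball (0 : EuclideanSpace ℝ (Fin d)) 1) ≤
      4 ^ d * ∫⁻ u in Metric.ball (0 : EuclideanSpace ℝ (Fin d)) 1,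
        (ENNReal.ofReal (Real.exp (8 * θ * quadForm M u)) +
          ENNReal.ofReal (Real.exp (-(8 * θ) * quadForm M u))) := by
  obtain ⟨v, hv1, hv⟩ := exists_abs_quadForm_ge hM
  set B := Metric.ball (0 : EuclideanSpace ℝ (Fin d)) 1
  set B' := Metric.ball ((3 / 4 : ℝ) • v) (1 / 4)
  have hsub : B' ⊆ B := by
    refine Metric.ball_subset_ball' ?_
    rw [dist_zero_right, norm_smul, hv1]
    norm_num
  -- The small ball depends on `M`. Enlarging the integral to the whole unit ball removes this
  -- dependence, so that Tonelli applies later; the volume ratio `4 ^ d` is the price, playing the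
  -- role of the size of a net.
  have hvol : volume B = 4 ^ d * volume B' := by
    rw [Measure.addHaar_ball volume ((3 / 4 : ℝ) • v) (by norm_num : (0 : ℝ) ≤ 1 / 4),
      finrank_euclideanSpace_fin, ← mul_assoc, ENNReal.ofReal_pow (by norm_num), ← mul_pow]
    have h : (4 : ENNReal) * ENNReal.ofReal (1 / 4) = 1 := by
      rw [← ENNReal.ofReal_ofNat 4, ← ENNReal.ofReal_mul (by norm_num)]
      norm_num
    rw [h, one_pow, one_mul]
  rw [hvol, mul_left_comm]
  gcongr
  rw [← setLIntegral_const]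
  refine (setLIntegral_mono' measurableSet_ball fun u hu => ?_).trans (lintegral_mono_set hsub)
  have h := hv u hu
  rcases le_total 0 (quadForm M u) with hq | hq
  · rw [abs_of_nonneg hq] at h
    refine le_add_right (ENNReal.ofReal_le_ofReal (Real.exp_le_exp.2 ?_))
    nlinarith
  · rw [abs_of_nonpos hq] at h
    refine le_add_left (ENNReal.ofReal_le_ofReal (Real.exp_le_exp.2 ?_))
    nlinarith

/-- Exponential moments of the operator norm deviation of a Gaussian sample covariance matrix. -/
theorem lintegral_exp_norm_sub_sampleCov_le [NeZero d] {Λ : Matrix (Fin d) (Fin d) ℝ}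
    (hΛ : Λ.PosSemidef) {b : ℝ} (hb : ‖Λ‖ ≤ b) (hm : 1 ≤ m) {θ : ℝ} (hθ : 0 ≤ θ)
    (hθb : 8 * θ * b ≤ m / 4) :
    ∫⁻ x, ENNReal.ofReal (Real.exp (θ * ‖Λ - sampleCov x‖))
        ∂(Measure.pi fun _ : Fin m => multivariateGaussian 0 Λ) ≤
      ENNReal.ofReal (4 ^ d * (2 * Real.exp (128 * θ ^ 2 * b ^ 2 / m))) := by
  set μ := Measure.pi fun _ : Fin m => multivariateGaussian 0 Λ with hμ
  set B := Metric.ball (0 : EuclideanSpace ℝ (Fin d)) 1 with hB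
  have hB0 : volume B ≠ 0 := (Metric.measure_ball_pos _ _ one_pos).ne'
  have hBt : volume B ≠ ⊤ := measure_ball_lt_top.ne
  set F : (Fin m → EuclideanSpace ℝ (Fin d)) → EuclideanSpace ℝ (Fin d) → ENNReal := fun x u =>
    ENNReal.ofReal (Real.exp (8 * θ * quadForm (Λ - sampleCov x) u)) +
      ENNReal.ofReal (Real.exp (-(8 * θ) * quadForm (Λ - sampleCov x) u)) with hF
  have hcont : Continuous fun p : (Fin m → EuclideanSpace ℝ (Fin d)) × EuclideanSpace ℝ (Fin d) =>
      quadForm (Λ - sampleCov p.1) p.2 :=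
    continuous_quadForm.comp
      ((continuous_const.sub (continuous_sampleCov.comp continuous_fst)).prodMk continuous_snd)
  have hexp : ∀ t : ℝ, Measurable fun p : (Fin m → EuclideanSpace ℝ (Fin d)) ×
      EuclideanSpace ℝ (Fin d) =>
        ENNReal.ofReal (Real.exp (t * quadForm (Λ - sampleCov p.1) p.2)) := fun t =>
    (Real.continuous_exp.comp (hcont.const_mul t)).measurable.ennreal_ofReal
  have hFm : Measurable (Function.uncurry F) := (hexp _).add (hexp _)
  have hbd : ∀ u ∈ B, ∫⁻ x, F x u ∂μ ≤
      ENNReal.ofReal (2 * Real.exp (128 * θ ^ 2 * b ^ 2 / m)) := by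
    intro u hu
    have hu1 : ‖u‖ ≤ 1 := (mem_ball_zero_iff.1 hu).le
    simp only [hF]
    have hcontu : Continuous fun x : Fin m → EuclideanSpace ℝ (Fin d) =>
        quadForm (Λ - sampleCov x) u :=
      hcont.comp (continuous_id.prodMk continuous_const)
    have hmeas : Measurable fun x : Fin m → EuclideanSpace ℝ (Fin d) =>
        ENNReal.ofReal (Real.exp (8 * θ * quadForm (Λ - sampleCov x) u)) :=
      (Real.continuous_exp.comp (hcontu.const_mul (8 * θ))).measurable.ennreal_ofReal
    rw [lintegral_add_left hmeas]
    have h1 := lintegral_exp_quadForm_le hΛ hb hm hu1 (θ := 8 * θ)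
      (by rwa [abs_of_nonneg (by positivity)])
    have h2 := lintegral_exp_quadForm_le hΛ hb hm hu1 (θ := -(8 * θ))
      (by rwa [abs_neg, abs_of_nonneg (by positivity)])
    refine (add_le_add h1 h2).trans_eq ?_
    rw [← ENNReal.ofReal_add (by positivity) (by positivity)]
    congr 1
    rw [two_mul (Real.exp _)]
    congr 2 <;> ring
  have hmain : (∫⁻ x, ENNReal.ofReal (Real.exp (θ * ‖Λ - sampleCov x‖)) ∂μ) * volume B ≤
      ENNReal.ofReal (4 ^ d * (2 * Real.exp (128 * θ ^ 2 * b ^ 2 / m))) * volume B := by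
    calc _ = ∫⁻ x, ENNReal.ofReal (Real.exp (θ * ‖Λ - sampleCov x‖)) * volume B ∂μ := by
          rw [lintegral_mul_const' _ _ hBt]
      _ ≤ ∫⁻ x, 4 ^ d * (∫⁻ u in B, F x u) ∂μ := by
          refine lintegral_mono fun x => ?_
          exact exp_norm_mul_volume_ball_le (hΛ.1.sub (isHermitian_sampleCov x)) hθ
      _ = 4 ^ d * ∫⁻ u in B, (∫⁻ x, F x u ∂μ) := by
          rw [lintegral_const_mul' _ _ (by finiteness), lintegral_lintegral_swap hFm.aemeasurable]
      _ ≤ 4 ^ d * ∫⁻ _u in B, ENNReal.ofReal (2 * Real.exp (128 * θ ^ 2 * b ^ 2 / m)) := by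
          gcongr 4 ^ d * ?_
          exact setLIntegral_mono' measurableSet_ball hbd
      _ = _ := by
          rw [setLIntegral_const, ← mul_assoc, ENNReal.ofReal_mul (p := 4 ^ d) (by positivity),
            ENNReal.ofReal_pow (by norm_num), ENNReal.ofReal_ofNat]
  exact (ENNReal.mul_le_mul_iff_left hB0 hBt).1 hmain

/-! ### Moments of the noise factor -/

theorem one_add_pow_le_mul_exp {y L : ℝ} (hy : 0 ≤ y) (hL : 1 ≤ L) (N : ℕ) :
    (1 + y) ^ N ≤ L ^ N * Real.exp (N * (y / L)) := by
  rw [Real.exp_nat_mul, ← mul_pow]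
  refine pow_le_pow_left₀ (by positivity) ?_ N
  calc 1 + y ≤ L * (y / L + 1) := by
        rw [mul_add, mul_div_cancel₀ _ (by positivity)]; linarith
    _ ≤ _ := by gcongr; exact Real.add_one_le_exp _

/-- The constant in the bound for the moments of order `4 k` of `1 + r ‖Λ - S‖`, with `S` a Gaussian
sample covariance matrix. -/
noncomputable def momentBound (b c₀ r : ℝ) : ℝ :=
  8 * Real.exp (512 * r * b / c₀ + 2048 * r ^ 2 * b ^ 2 / c₀)

theorem lintegral_one_add_pow_le [NeZero d] {Λ : Matrix (Fin d) (Fin d) ℝ}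
    (hΛ : Λ.PosSemidef) {b c₀ r τ : ℝ} (hb : ‖Λ‖ ≤ b) (hb0 : 0 < b) (hc₀ : 0 < c₀) (hr : 0 < r)
    (hτ : 0 < τ) (hτ1 : τ ≤ 1) (hm : 1 ≤ m) {k : ℕ} (hk : 1 ≤ k)
    (hkm : c₀ * ((k : ℝ) ^ 2 * d) = τ ^ 2 * m) :
    ∫⁻ x, ENNReal.ofReal ((1 + r * ‖Λ - sampleCov x‖) ^ (4 * k))
        ∂(Measure.pi fun _ : Fin m => multivariateGaussian 0 Λ) ≤
      ENNReal.ofReal (1 + τ * (2 * momentBound b c₀ r)) := by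
  set μ := Measure.pi fun _ : Fin m => multivariateGaussian 0 Λ with hμ
  have hd' : (0 : ℝ) < d := by exact_mod_cast Nat.pos_of_ne_zero (NeZero.ne d)
  have hm' : (0 : ℝ) < m := by exact_mod_cast hm
  have hk' : (0 : ℝ) < k := by exact_mod_cast hk
  set G := momentBound b c₀ r with hG
  have hG0 : 0 < G := by rw [hG, momentBound]; positivity
  -- `L` trades exponential rate for a prefactor: it is large enough for `θ` to satisfy `8 * θ * b ≤
  -- m / 4`, yet so close to one that `L ^ (4 * k * d)` is only exponential in `d`.
  set L : ℝ := 1 + 128 * r * b / c₀ / k with hL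
  have hLk : 128 * r * b / c₀ / k ≤ L := by rw [hL]; linarith
  have hL1 : 1 ≤ L := by
    have : 0 ≤ 128 * r * b / c₀ / k := by positivity
    rw [hL]; linarith
  have hL0 : 0 < L := by linarith
  set θ : ℝ := 4 * k * d * (r / τ) / L with hθ
  have hθ0 : 0 ≤ θ := by positivity
  have hθb : 8 * θ * b ≤ m / 4 := by
    have h1 : θ ≤ 4 * k * d * (r / τ) / (128 * r * b / c₀ / k) := by rw [hθ]; gcongr
    have h2 : 4 * k * d * (r / τ) / (128 * r * b / c₀ / k) = τ * m / (32 * b) := by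
      have h3 : (d : ℝ) = τ ^ 2 * m / (c₀ * k ^ 2) := by
        rw [← hkm]; field_simp
      rw [h3]
      field_simp
      ring
    have h3 : τ * m / (32 * b) ≤ 1 * m / (32 * b) := by gcongr
    calc 8 * θ * b ≤ 8 * (1 * m / (32 * b)) * b := by gcongr; exact (h1.trans_eq h2).trans h3
      _ = m / 4 := by field_simp; ring
  have hθsq : 128 * θ ^ 2 * b ^ 2 / m ≤ d * (2048 * r ^ 2 * b ^ 2 / c₀) := by
    have h1 : θ ≤ 4 * k * d * (r / τ) := by
      rw [hθ]; exact div_le_self (by positivity) hL1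
    calc 128 * θ ^ 2 * b ^ 2 / m ≤ 128 * (4 * k * d * (r / τ)) ^ 2 * b ^ 2 / m := by gcongr
      _ = d * (2048 * r ^ 2 * b ^ 2 / c₀) := by
        have h3 : c₀ = τ ^ 2 * m / (k ^ 2 * d) := by rw [← hkm]; field_simp
        rw [h3]
        field_simp
        ring
  have hLpow : L ^ (4 * k * d) ≤ Real.exp (d * (512 * r * b / c₀)) := by
    have h1 : L ≤ Real.exp (128 * r * b / c₀ / k) := by
      rw [hL, add_comm]; exact Real.add_one_le_exp _
    refine (pow_le_pow_left₀ hL0.le h1 _).trans_eq ?_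
    rw [← Real.exp_nat_mul]
    congr 1
    push_cast
    field_simp
    ring
  -- This fixes `momentBound`: `8 = 4 * 2` comes from the volume ratio and the two signs of the
  -- form, `512` from `L ^ (4 * k * d)`, and `2048 = 128 * 4 ^ 2` from the Gaussian exponent.
  have hGd : Real.exp (d * (512 * r * b / c₀)) *
      (4 ^ d * (2 * Real.exp (128 * θ ^ 2 * b ^ 2 / m))) ≤ G ^ d := by
    calc _ ≤ Real.exp (d * (512 * r * b / c₀)) *
          (4 ^ d * (2 ^ d * Real.exp (d * (2048 * r ^ 2 * b ^ 2 / c₀)))) := by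
          gcongr
          exact le_self_pow₀ one_le_two (NeZero.ne d)
      _ = G ^ d := by
          rw [hG, momentBound, mul_pow, ← Real.exp_nat_mul, mul_add, Real.exp_add,
            show (8 : ℝ) = 4 * 2 by norm_num, mul_pow]
          ring
  have hpt : ∀ η : ℝ, 0 ≤ η → (1 + r * η) ^ (4 * k) ≤ (1 + τ * G) +
      τ * G * (G ^ d)⁻¹ * Real.exp (d * (512 * r * b / c₀)) * Real.exp (θ * η) := by
    intro η hη
    set y := r / τ * η with hy
    have hy0 : 0 ≤ y := by positivity
    have hry : r * η = τ * y := by rw [hy]; field_simp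
    -- Convexity between `1` and `1 + y` makes the excess over one linear in `τ`; this is why the
    -- noise was rescaled by `1 / τ`.
    have hconv : (1 + τ * y) ^ (4 * k) ≤ 1 + τ * (1 + y) ^ (4 * k) := by
      have h := (convexOn_pow (4 * k)).2 (Set.mem_Ici.2 zero_le_one)
        (Set.mem_Ici.2 (by positivity : 0 ≤ 1 + y)) (sub_nonneg.2 hτ1) hτ.le (by ring)
      simp only [smul_eq_mul, one_pow, mul_one] at h
      have h2 : (1 - τ) + τ * (1 + y) = 1 + τ * y := by ring
      rw [h2] at h
      linarith
    set z := (1 + y) ^ (4 * k) with hz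
    have hz0 : 0 ≤ z := by positivity
    -- A pointwise substitute for `E z ≤ (E z ^ d) ^ (1 / d)`: it reduces the mean of `z` to a
    -- `d`-th moment of size at most `G ^ d`.
    have hzG : z ≤ G + G * (G ^ d)⁻¹ * z ^ d := by
      have h1 : G * (G ^ d)⁻¹ * z ^ d = G * (z / G) ^ d := by
        rw [div_pow]; field_simp
      rw [h1]
      rcases le_total z G with h | h
      · have : 0 ≤ G * (z / G) ^ d := by positivity
        linarith
      · have h2 : z / G ≤ (z / G) ^ d :=
          le_self_pow₀ ((one_le_div hG0).2 h) (NeZero.ne d)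
        have h3 : z = G * (z / G) := by field_simp
        have h4 := mul_le_mul_of_nonneg_left h2 hG0.le
        linarith
    have hzd : z ^ d ≤ Real.exp (d * (512 * r * b / c₀)) * Real.exp (θ * η) := by
      rw [hz, ← pow_mul]
      have h1 : ((4 * k * d : ℕ) : ℝ) * (y / L) = θ * η := by
        rw [hθ, hy]
        push_cast
        ring
      refine (one_add_pow_le_mul_exp hy0 hL1 _).trans ?_
      rw [h1]
      gcongr
    rw [hry]
    refine hconv.trans ?_
    calc 1 + τ * z ≤ 1 + τ * (G + G * (G ^ d)⁻¹ *
          (Real.exp (d * (512 * r * b / c₀)) * Real.exp (θ * η))) := by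
          gcongr
          refine hzG.trans ?_
          gcongr
      _ = _ := by ring
  set K := τ * G * (G ^ d)⁻¹ * Real.exp (d * (512 * r * b / c₀)) with hK
  have hK0 : 0 ≤ K := by positivity
  calc _ ≤ ∫⁻ x, (ENNReal.ofReal (1 + τ * G) +
        ENNReal.ofReal K * ENNReal.ofReal (Real.exp (θ * ‖Λ - sampleCov x‖))) ∂μ := by
        refine lintegral_mono fun x => ?_
        rw [← ENNReal.ofReal_mul hK0, ← ENNReal.ofReal_add (by positivity) (by positivity)]
        exact ENNReal.ofReal_le_ofReal (hpt _ (norm_nonneg _))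
    _ = ENNReal.ofReal (1 + τ * G) + ENNReal.ofReal K *
        ∫⁻ x, ENNReal.ofReal (Real.exp (θ * ‖Λ - sampleCov x‖)) ∂μ := by
        rw [lintegral_add_left measurable_const, lintegral_const_mul' _ _ ENNReal.ofReal_ne_top,
          lintegral_const, measure_univ, mul_one]
    _ ≤ ENNReal.ofReal (1 + τ * G) + ENNReal.ofReal K *
        ENNReal.ofReal (4 ^ d * (2 * Real.exp (128 * θ ^ 2 * b ^ 2 / m))) := by
        gcongr
        exact lintegral_exp_norm_sub_sampleCov_le hΛ hb hm hθ0 hθb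
    _ = ENNReal.ofReal (1 + τ * G +
        τ * G * (G ^ d)⁻¹ * (Real.exp (d * (512 * r * b / c₀)) *
          (4 ^ d * (2 * Real.exp (128 * θ ^ 2 * b ^ 2 / m))))) := by
        rw [← ENNReal.ofReal_mul hK0, ← ENNReal.ofReal_add (by positivity) (by positivity), hK]
        ring_nf
    _ ≤ ENNReal.ofReal (1 + τ * G + τ * G * (G ^ d)⁻¹ * G ^ d) := by gcongr
    _ = _ := by
        congr 1
        field_simp
        ring
end

/-! ### Conclusion -/

theorem theorem3 (a b c₀ : ℝ) (ha : 0 < a) (hc₀ : 0 < c₀) :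
    ∃ C : ℝ → ℝ, Monotone C ∧
      ∀ (d n m k : ℕ) (Λ : Matrix (Fin d) (Fin d) ℝ) (hΛ : Λ.IsHermitian) (c : ℝ),
        1 ≤ d → 1 ≤ n → 1 ≤ k → c ≠ 0 →
        (∀ i, a ≤ hΛ.eigenvalues i ∧ hΛ.eigenvalues i ≤ b) →
        c₀ * ((k : ℝ) ^ 2 * (d : ℝ)) ≤ (m : ℝ) →
        ∀ j : ℕ, (j = k ∨ j = k + 1) →
          Integrable (fun p => ‖cotEstimate c n Λ p.1 p.2 j - p.2‖ ^ 2) (testLaw m Λ) ∧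
          ∫ p, ‖cotEstimate c n Λ p.1 p.2 j - p.2‖ ^ 2 ∂(testLaw m Λ) ≤
            Matrix.trace ((1 - (gammaMat n Λ)⁻¹ * Λ) ^ (2 * k)) *
              (1 + C ((n : ℝ) / (d : ℝ)) * ((k : ℝ) * Real.sqrt ((d : ℝ) / (m : ℝ)))) := by
  -- The truncation `max ν 0` and `|b|` make the witness monotone on all of `ℝ`, before any
  -- eigenvalue shows that `b > 0`; both are harmless at `ν = n / d`. The factor `√c₀` is the one in
  -- `τ`.
  refine ⟨fun ν => √c₀ * (2 * momentBound |b| c₀ (max ν 0 / a)), ?_, ?_⟩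
  · intro ν ν' h
    simp only [momentBound]
    have : max ν 0 ≤ max ν' 0 := max_le_max_right _ h
    have h0 : 0 ≤ max ν 0 := le_max_right _ _
    gcongr
  intro d n m k Λ hΛ c hd hn hk hc hev hm j hj
  have : NeZero d := ⟨by omega⟩
  have hd' : (0 : ℝ) < d := by exact_mod_cast hd
  have hn' : (0 : ℝ) < n := by exact_mod_cast hn
  have hk' : (0 : ℝ) < k := by exact_mod_cast hk
  have hm' : (0 : ℝ) < m := lt_of_lt_of_le (by positivity) hm
  have hm1 : 1 ≤ m := by exact_mod_cast hm'
  have hab : a ≤ b := (hev ⟨0, hd⟩).1.trans (hev ⟨0, hd⟩).2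
  have hb0 : 0 < b := ha.trans_le hab
  have hpsd : Λ.PosSemidef := hΛ.posSemidef_iff_eigenvalues_nonneg.2 fun i => ha.le.trans (hev i).1
  have hnorm : ‖Λ‖ ≤ b := by
    conv_lhs => rw [hΛ.spectral_theorem]
    rw [norm_conjStarAlgAut, Matrix.l2_opNorm_diagonal, pi_norm_le_iff_of_nonneg hb0.le]
    intro i
    have h := hev i
    simp only [Function.comp_apply, Real.norm_eq_abs, RCLike.ofReal_real_eq_id, id]
    rw [abs_of_nonneg (ha.le.trans h.1)]
    exact h.2
  set r : ℝ := n / d / a with hr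
  have hr0 : 0 < r := by positivity
  set τ : ℝ := √c₀ * (k * √(d / m)) with hτ
  have hτ0 : 0 < τ := by
    have : 0 < √c₀ := Real.sqrt_pos.2 hc₀
    have : 0 < √((d : ℝ) / m) := Real.sqrt_pos.2 (by positivity)
    positivity
  have hτ2 : c₀ * ((k : ℝ) ^ 2 * d) = τ ^ 2 * m := by
    rw [hτ, mul_pow, mul_pow, Real.sq_sqrt hc₀.le, Real.sq_sqrt (by positivity)]
    field_simp
  have hτ1 : τ ≤ 1 := by
    rw [hτ2] at hm
    have : τ ^ 2 ≤ 1 := by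
      by_contra! h
      nlinarith
    nlinarith
  set T := Matrix.trace ((1 - (gammaMat n Λ)⁻¹ * Λ) ^ (2 * k)) with hT
  set B : (Fin m → EuclideanSpace ℝ (Fin d)) → Matrix (Fin d) (Fin d) ℝ := fun x =>
    1 - (gammaMat n Λ)⁻¹ * sampleCov x with hB
  have hBc : Continuous B := continuous_const.sub (continuous_const.matrix_mul continuous_sampleCov)
  have hT0 : 0 ≤ T := by
    obtain ⟨U, α, P, hα0, -, hA, -⟩ :=
      exists_factorization_gammaMat hΛ ha hd hn fun i => (hev i).1
    rw [hT, hA, ← map_pow, trace_conjStarAlgAut, Matrix.diagonal_pow, Matrix.trace_diagonal]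
    exact Finset.sum_nonneg fun i _ => pow_nonneg (hα0 i) _
  set f : (Fin m → EuclideanSpace ℝ (Fin d)) × EuclideanSpace ℝ (Fin d) → ℝ := fun p =>
    ‖cotEstimate c n Λ p.1 p.2 j - p.2‖ ^ 2 with hf
  have hfeq : f = fun p => ‖(WithLp.toLp 2 (-((B p.1 ^ j).mulVec p.2.ofLp)) :
      EuclideanSpace ℝ (Fin d))‖ ^ 2 := by
    funext p
    simp only [hf, cotEstimate_sub_eq hc, hB]
  have hfc : Continuous f := by
    rw [hfeq]
    have h : Continuous fun p : (Fin m → EuclideanSpace ℝ (Fin d)) × EuclideanSpace ℝ (Fin d) =>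
        (B p.1 ^ j).mulVec p.2.ofLp :=
      Continuous.matrix_mulVec ((hBc.comp continuous_fst).pow j) (by fun_prop)
    fun_prop
  -- As a lower Lebesgue integral, this single bound yields both integrability and the estimate.
  have hlint : ∫⁻ p, ENNReal.ofReal (f p) ∂(testLaw m Λ) ≤
      ENNReal.ofReal (T * (1 + τ * (2 * momentBound b c₀ r))) := by
    rw [testLaw, lintegral_prod _ hfc.measurable.ennreal_ofReal.aemeasurable]
    calc _ = ∫⁻ x, ENNReal.ofReal ((B x ^ j).transpose * B x ^ j).trace
          ∂(Measure.pi fun _ : Fin m => multivariateGaussian 0 Λ) := by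
          refine lintegral_congr fun x => ?_
          rw [← lintegral_norm_sq_mulVec, hfeq]
      _ ≤ ∫⁻ x, ENNReal.ofReal T * ENNReal.ofReal ((1 + r * ‖Λ - sampleCov x‖) ^ (4 * k))
          ∂(Measure.pi fun _ : Fin m => multivariateGaussian 0 Λ) := by
          refine lintegral_mono fun x => ?_
          rw [← ENNReal.ofReal_mul hT0]
          exact ENNReal.ofReal_le_ofReal (trace_transpose_pow_mul_pow_residual_le hΛ ha hd hn
            (fun i => (hev i).1) _ hk (by omega) (by omega))
      _ ≤ ENNReal.ofReal T * ENNReal.ofReal (1 + τ * (2 * momentBound b c₀ r)) := by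
          rw [lintegral_const_mul' _ _ ENNReal.ofReal_ne_top]
          gcongr
          exact lintegral_one_add_pow_le hpsd hnorm hb0 hc₀ hr0 hτ0 hτ1 hm1 hk hτ2
      _ = _ := (ENNReal.ofReal_mul hT0).symm
  have hG0 : 0 ≤ momentBound b c₀ r := by rw [momentBound]; positivity
  have hf0 : ∀ p, 0 ≤ f p := fun p => by positivity
  refine ⟨⟨hfc.aestronglyMeasurable, ?_⟩, ?_⟩
  · rw [hasFiniteIntegral_iff_ofReal (ae_of_all _ hf0)]
    exact hlint.trans_lt ENNReal.ofReal_lt_top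
  · rw [integral_eq_lintegral_of_nonneg_ae (ae_of_all _ hf0) hfc.aestronglyMeasurable]
    refine (ENNReal.toReal_le_of_le_ofReal (by positivity) hlint).trans_eq ?_
    beta_reduce
    rw [abs_of_pos hb0, max_eq_left (by positivity : (0 : ℝ) ≤ n / d), ← hr, hτ]
    ring
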